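/- There is an algorithm with the following property. Its input is an instance with $n\ge 1$ teams and $m$ players, in which each team $i$ has a nonnegative integer value $v_i(p)$ for each player $p$ (extended additively to sets of players by $v_i(S)=\sum_{p\in S}v_i(p)$), and each player $p$ has a weak order (complete and transitive preference) $\succsim_p$ over the teams. Its output is an allocation $A=(A_1,\dots,A_n)$, i.e., an ordered partition of the players into $n$ possibly empty parts, that is - EF1 (envy-free up to one player): for all distinct teams $i,j$ there are $X\subseteq A_i$ and $Y\subseteq A_j$ with $|X\cup Y|\le 1$ and $v_i(A_i\setminus X)\ge v_i(A_j\setminus Y)$; and - PO (Pareto optimal): there is no allocation in which no team and no player is worse off than in $A$ and at least one team or player is better off (teams judge an allocation by the value of their part, players by the team they are assigned to). For every constant number $n$ of teams, the algorithm runs in pseudopolynomial time: there is a polynomial $q_n$, depending only on $n$, such that on every instance with $n$ teams and $m$ players the algorithm halts within $q_n(m+v_{\max})$ steps, where $v_{\max}=\max_{i,p}v_i(p)$ (and $v_{\max}=0$ if $m=0$). Here the algorithm is a program for a unit-cost random access machine whose arithmetic instructions are addition and truncated subtraction, with the values $v_i(p)$ and the ranks ($1$ plus the number of teams that $p$ strictly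 prefers to $i$) given in its memory. -/

import Mathlib

namespace TeamAlloc

/-! ### Instances, allocations, fairness and efficiency -/

/-- An instance with teams `Fin n` and players `Fin m`. Team `i` has the nonnegative integer value
`v i p` for player `p` (and values sets of players additively, see `value`). Player `p` has a
weak order over the teams: `pref p i j` says that `p` finds team `i` at least as good as `j`. -/
structure Market (n m : ℕ) where
  v : Fin n → Fin m → ℕ
  pref : Fin m → Fin n → Fin n → Prop
  pref_total : ∀ p i j, pref p i j ∨ pref p j i
  pref_trans : ∀ p i j k, pref p i j → pref p j k → pref p i k

/-- An allocation is an ordered partition of the players into `n` (possibly empty) parts; it is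
given by the team of each player. -/
abbrev Allocation (n m : ℕ) := Fin m → Fin n

/-- The part `A_i` that the allocation `A` assigns to team `i`. -/
def Allocation.part {n m : ℕ} (A : Allocation n m) (i : Fin n) : Finset (Fin m) :=
  Finset.univ.filter fun p => A p = i

namespace Market

variable {n m : ℕ} (I : Market n m)

/-- The additive valuation of team `i`. -/
def value (i : Fin n) (S : Finset (Fin m)) : ℕ := ∑ p ∈ S, I.v i p

/-- Player `p` strictly prefers team `i` to team `j`. -/
def strictPref (p : Fin m) (i j : Fin n) : Prop := I.pref p i j ∧ ¬ I.pref p j i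

/-- The rank of team `i` for player `p`: one plus the number of teams `j` that `p` strictly
prefers to `i`. -/
noncomputable def rank (p : Fin m) (i : Fin n) : ℕ := 1 + Set.ncard {j | I.strictPref p j i}

/-- The largest value of a team for a player (`0` if there is no team or no player). -/
def vmax : ℕ := Finset.univ.sup fun x : Fin n × Fin m => I.v x.1 x.2

/-- Envy-freeness up to one player. -/
def EF1 (A : Allocation n m) : Prop :=
  ∀ i j : Fin n, i ≠ j → ∃ X ⊆ A.part i, ∃ Y ⊆ A.part j,
    (X ∪ Y).card ≤ 1 ∧ I.value i (A.part j \ Y) ≤ I.value i (A.part i \ X)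

/-- `A'` is a Pareto improvement of `A`: no party (team or player) is worse off in `A'`,
and at least one party is better off. -/
def ParetoDominates (A' A : Allocation n m) : Prop :=
  (∀ i, I.value i (A.part i) ≤ I.value i (A'.part i)) ∧
  (∀ p, I.pref p (A' p) (A p)) ∧
  ((∃ i, I.value i (A.part i) < I.value i (A'.part i)) ∨ ∃ p, I.strictPref p (A' p) (A p))

/-- Pareto optimality with respect to all parties, teams and players. -/
def PO (A : Allocation n m) : Prop := ∀ A' : Allocation n m, ¬ I.ParetoDominates A' A

end Market

/-! ### A unit-cost random access machine

The memory holds natural numbers: registers `reg x` with a fixed number in the program, and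
arrays `arr a` with a fixed number in the program, whose cells are addressed indirectly.
The only arithmetic is addition and truncated subtraction (no multiplication), so that a value at
most doubles with each step and unit cost is polynomially related to bit cost and to the
running time of a Turing machine. -/

/-- The memory of the machine. -/
structure Mem where
  reg : ℕ → ℕ
  arr : ℕ → ℕ → ℕ

/-- Write `k` into register `x`. -/
def Mem.setReg (s : Mem) (x k : ℕ) : Mem := { s with reg := Function.update s.reg x k }

/-- Write `k` into cell `j` of array `a`. -/
def Mem.setArr (s : Mem) (a j k : ℕ) : Mem :=
  { s with arr := Function.update s.arr a (Function.update (s.arr a) j k) }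

/-- Programs of the machine. -/
inductive Program where
  /-- `reg x := k` -/
  | const (x k : ℕ)
  /-- `reg x := reg y + reg z` -/
  | add (x y z : ℕ)
  /-- `reg x := max (reg y - reg z) 0` -/
  | sub (x y z : ℕ)
  /-- `reg x := arr a [reg y]` -/
  | load (x a y : ℕ)
  /-- `arr a [reg x] := reg y` -/
  | store (a x y : ℕ)
  /-- first `c`, then `d` -/
  | seq (c d : Program)
  /-- `c` if `reg x` is nonzero, otherwise `d` -/
  | cond (x : ℕ) (c d : Program)
  /-- repeat `c` as long as `reg x` is nonzero (tested before each round) -/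
  | loop (x : ℕ) (c : Program)

/-- `Exec c s t s'`: the program `c`, started with memory `s`, halts after exactly `t` steps with
memory `s'`. Each elementary instruction and each test of a register costs one step. -/
inductive Exec : Program → Mem → ℕ → Mem → Prop where
  | const (x k : ℕ) (s : Mem) : Exec (.const x k) s 1 (s.setReg x k)
  | add (x y z : ℕ) (s : Mem) : Exec (.add x y z) s 1 (s.setReg x (s.reg y + s.reg z))
  | sub (x y z : ℕ) (s : Mem) : Exec (.sub x y z) s 1 (s.setReg x (s.reg y - s.reg z))
  | load (x a y : ℕ) (s : Mem) : Exec (.load x a y) s 1 (s.setReg x (s.arr a (s.reg y)))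
  | store (a x y : ℕ) (s : Mem) : Exec (.store a x y) s 1 (s.setArr a (s.reg x) (s.reg y))
  | seq {c d : Program} {s s₁ s₂ : Mem} {t₁ t₂ : ℕ} :
      Exec c s t₁ s₁ → Exec d s₁ t₂ s₂ → Exec (.seq c d) s (t₁ + t₂) s₂
  | cond_true {x : ℕ} {c d : Program} {s s₁ : Mem} {t : ℕ} :
      s.reg x ≠ 0 → Exec c s t s₁ → Exec (.cond x c d) s (t + 1) s₁
  | cond_false {x : ℕ} {c d : Program} {s s₁ : Mem} {t : ℕ} :
      s.reg x = 0 → Exec d s t s₁ → Exec (.cond x c d) s (t + 1) s₁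
  | loop_done {x : ℕ} {c : Program} {s : Mem} :
      s.reg x = 0 → Exec (.loop x c) s 1 s
  | loop_round {x : ℕ} {c : Program} {s s₁ s₂ : Mem} {t₁ t₂ : ℕ} :
      s.reg x ≠ 0 → Exec c s t₁ s₁ → Exec (.loop x c) s₁ t₂ s₂ →
        Exec (.loop x c) s (t₁ + t₂ + 1) s₂

/-- The machine is deterministic: the number of steps and the final memory are determined by the
program and the initial memory. -/
theorem Exec.deterministic {c : Program} {s s₁ s₂ : Mem} {t₁ t₂ : ℕ}
    (h₁ : Exec c s t₁ s₁) (h₂ : Exec c s t₂ s₂) : t₁ = t₂ ∧ s₁ = s₂ := by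
  induction h₁ generalizing t₂ s₂ with
  | const | add | sub | load | store => cases h₂; exact ⟨rfl, rfl⟩
  | seq _ _ ih ih' =>
    cases h₂ with
    | seq a b =>
      obtain ⟨rfl, rfl⟩ := ih a
      obtain ⟨rfl, rfl⟩ := ih' b
      exact ⟨rfl, rfl⟩
  | cond_true hx _ ih =>
    cases h₂ with
    | cond_true _ a => obtain ⟨rfl, rfl⟩ := ih a; exact ⟨rfl, rfl⟩
    | cond_false hy _ => exact absurd hy hx
  | cond_false hx _ ih =>
    cases h₂ with
    | cond_true hy _ => exact absurd hx hy
    | cond_false _ a => obtain ⟨rfl, rfl⟩ := ih a; exact ⟨rfl, rfl⟩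
  | loop_done hx =>
    cases h₂ with
    | loop_done _ => exact ⟨rfl, rfl⟩
    | loop_round hy _ _ => exact absurd hx hy
  | loop_round hx _ _ ih ih' =>
    cases h₂ with
    | loop_done hy => exact absurd hy hx
    | loop_round _ a b =>
      obtain ⟨rfl, rfl⟩ := ih a
      obtain ⟨rfl, rfl⟩ := ih' b
      exact ⟨rfl, rfl⟩

/-- An `m × n` table as the content of an array: the entry for player `p` and team `i` is in cell
`p * n + i`, all other cells are `0`. -/
def tableArr {n m : ℕ} (f : Fin m → Fin n → ℕ) (k : ℕ) : ℕ :=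
  if h : k < m * n then f (Fin.divNat ⟨k, h⟩) (Fin.modNat ⟨k, h⟩) else 0

/-- The initial memory on an instance: register `0` holds the number of teams, register `1` the
number of players, array `0` the values of the players for the teams, array `1` the ranks of
the teams for the players; everything else is `0`. -/
noncomputable def Market.input {n m : ℕ} (I : Market n m) : Mem where
  reg x := if x = 0 then n else if x = 1 then m else 0
  arr a := if a = 0 then tableArr fun p i => I.v i p else if a = 1 then tableArr I.rank else 0

/-- Started on the instance `I`, the program `c` halts within `T` steps and outputs the
allocation `A`: for each player `p`, cell `p` of array `2` holds the team of `p`. -/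
def Program.OutputsWithin (c : Program) {n m : ℕ} (I : Market n m) (A : Allocation n m) (T : ℕ) :
    Prop :=
  ∃ t ≤ T, ∃ s : Mem, Exec c I.input t s ∧ ∀ p : Fin m, s.arr 2 p = A p

end TeamAlloc

namespace TeamAlloc

/-! ### Reasoning about programs -/

section Memory

variable (s : Mem)

/-! Take an allocation that maximizes ∏ᵢ (vᵢ(Aᵢ) + 1) and, among the maximizers, minimizes the sum
of the ranks that players give to their teams (`Market.Optimal`). A Pareto improvement would either
raise the product or keep it and lower the total rank, so `A` is PO (`Optimal.po`). For EF1, moving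
a player `g` from team `j` to team `i` cannot raise the product (`Optimal.move_le`); if `i` envied
`j` after the removal of any single player, summing these inequalities over `g ∈ A_j` would be
contradictory (`Optimal.ef1`). The shift by 1 keeps all factors positive, so teams with value 0 need
no special treatment.

Such an allocation is found by dynamic programming. With a base `B` above every possible value of a
part, the vector of team values is a number below `B ^ n`, and adding a player to a team adds a
fixed weight to it. For each index reached, `layer` keeps the least total rank, encoded as `K` minus
that rank so that 0 means unreachable (`le_layer`, `layer_assign`). One scan over all indices of `K`
times the product plus this entry handles both criteria (`optimal_bestAllocation`). The table has `m
* B ^ n` entries with `B ≤ 1 + m * n * vmax`, which is polynomial for fixed `n`.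

The machine cannot multiply, so powers, weights and products are all built by repeated addition.
Each program piece is verified with a Hoare logic that counts steps (`WP`), up to `wp_optimize`. -/

@[simp] theorem Mem.reg_setReg (x k y : ℕ) :
    (s.setReg x k).reg y = if y = x then k else s.reg y := by
  simp [Mem.setReg, Function.update_apply]

@[simp] theorem Mem.arr_setReg (x k : ℕ) : (s.setReg x k).arr = s.arr := rfl

@[simp] theorem Mem.reg_setArr (a j k : ℕ) : (s.setArr a j k).reg = s.reg := rfl

theorem Mem.arr_setArr (a j k b : ℕ) :
    (s.setArr a j k).arr b = if b = a then Function.update (s.arr b) j k else s.arr b := by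
  by_cases h : b = a
  · subst h; simp [Mem.setArr]
  · simp [Mem.setArr, h]

@[simp] theorem Mem.arr_setArr_self (a j k l : ℕ) :
    (s.setArr a j k).arr a l = if l = j then k else s.arr a l := by
  simp [Mem.arr_setArr, Function.update_apply]

@[simp] theorem Mem.arr_setArr_of_ne {a b : ℕ} (h : b ≠ a) (j k : ℕ) :
    (s.setArr a j k).arr b = s.arr b := by
  simp [Mem.arr_setArr, h]

end Memory

/-! ### Hoare logic with step bounds and frame conditions. -/

namespace Program

/-- Does the program contain an instruction that writes into register `x`? -/
def writesReg (x : ℕ) : Program → Bool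
  | const y _ => x == y
  | add y _ _ => x == y
  | sub y _ _ => x == y
  | load y _ _ => x == y
  | store _ _ _ => false
  | seq c d => c.writesReg x || d.writesReg x
  | cond _ c d => c.writesReg x || d.writesReg x
  | loop _ c => c.writesReg x

/-- Does the program contain an instruction that writes into array `a`? -/
def writesArr (a : ℕ) : Program → Bool
  | store b _ _ => a == b
  | seq c d => c.writesArr a || d.writesArr a
  | cond _ c d => c.writesArr a || d.writesArr a
  | loop _ c => c.writesArr a
  | _ => false

/-- The memories `s` and `s'` agree on all registers and arrays that `c` does not write. -/
structure Frame (c : Program) (s s' : Mem) : Prop where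
  reg : ∀ x, c.writesReg x = false → s'.reg x = s.reg x
  arr : ∀ a, c.writesArr a = false → s'.arr a = s.arr a

/-- Since `writesReg` and `writesArr` compute, preservation of a concrete register or array by a
concrete program is then proved by `rfl`. -/
theorem _root_.TeamAlloc.Exec.frame {c : Program} {s s' : Mem} {t : ℕ} (h : Exec c s t s') :
    c.Frame s s' := by
  induction h with
  | const | add | sub | load =>
    constructor
    · intro y hy
      simp only [writesReg, beq_eq_false_iff_ne] at hy
      simp [hy]
    · intro a _
      rfl
  | store =>
    constructor
    · intro y _
      rfl
    · intro b hb
      simp only [writesArr, beq_eq_false_iff_ne] at hb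
      simp [hb]
  | seq _ _ ih ih' =>
    constructor
    · intro x hx
      simp only [writesReg, Bool.or_eq_false_iff] at hx
      rw [ih'.reg x hx.2, ih.reg x hx.1]
    · intro x hx
      simp only [writesArr, Bool.or_eq_false_iff] at hx
      rw [ih'.arr x hx.2, ih.arr x hx.1]
  | cond_true _ _ ih =>
    constructor
    · intro x hx
      simp only [writesReg, Bool.or_eq_false_iff] at hx
      exact ih.reg x hx.1
    · intro x hx
      simp only [writesArr, Bool.or_eq_false_iff] at hx
      exact ih.arr x hx.1
  | cond_false _ _ ih =>
    constructor
    · intro x hx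
      simp only [writesReg, Bool.or_eq_false_iff] at hx
      exact ih.reg x hx.2
    · intro x hx
      simp only [writesArr, Bool.or_eq_false_iff] at hx
      exact ih.arr x hx.2
  | loop_done => exact ⟨fun _ _ => rfl, fun _ _ => rfl⟩
  | loop_round _ _ _ ih ih' =>
    constructor
    · intro x hx
      rw [ih'.reg x hx, ih.reg x hx]
    · intro x hx
      rw [ih'.arr x hx, ih.arr x hx]

/-- Started with memory `s`, the program `c` halts within `T` steps, with a memory that
satisfies `Q`. -/
def WP (c : Program) (s : Mem) (T : ℕ) (Q : Mem → Prop) : Prop :=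
  ∃ t ≤ T, ∃ s', Exec c s t s' ∧ Q s'

section Rules

variable {c d : Program} {s : Mem} {T T₁ T₂ : ℕ} {Q Q' : Mem → Prop}

theorem WP.mono (h : c.WP s T₁ Q') (hT : T₁ ≤ T) (hQ : ∀ s', c.Frame s s' → Q' s' → Q s') :
    c.WP s T Q := by
  obtain ⟨t, ht, s', he, hq⟩ := h
  exact ⟨t, ht.trans hT, s', he, hQ s' he.frame hq⟩

theorem WP.seq (h : c.WP s T₁ Q') (h' : ∀ s', c.Frame s s' → Q' s' → d.WP s' T₂ Q) :
    (c.seq d).WP s (T₁ + T₂) Q := by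
  obtain ⟨t, ht, s', he, hq⟩ := h
  obtain ⟨t', ht', s'', he', hq'⟩ := h' s' he.frame hq
  exact ⟨t + t', add_le_add ht ht', s'', he.seq he', hq'⟩

end Rules

/-- The effect of a program without loops on the memory. -/
def eval : Program → Mem → Mem
  | const x k, s => s.setReg x k
  | add x y z, s => s.setReg x (s.reg y + s.reg z)
  | sub x y z, s => s.setReg x (s.reg y - s.reg z)
  | load x a y, s => s.setReg x (s.arr a (s.reg y))
  | store a x y, s => s.setArr a (s.reg x) (s.reg y)
  | seq c d, s => d.eval (c.eval s)
  | cond x c d, s => if s.reg x = 0 then d.eval s else c.eval s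
  | loop _ _, s => s

/-- A bound on the number of steps of a program without loops. -/
def cost : Program → ℕ
  | seq c d => c.cost + d.cost
  | cond _ c d => max c.cost d.cost + 1
  | _ => 1

/-- The program does not contain loops. -/
def loopFree : Program → Bool
  | seq c d => c.loopFree && d.loopFree
  | cond _ c d => c.loopFree && d.loopFree
  | loop _ _ => false
  | _ => true

theorem exec_eval (c : Program) (hc : c.loopFree = true) (s : Mem) :
    ∃ t ≤ c.cost, Exec c s t (c.eval s) := by
  induction c generalizing s with
  | const x k => exact ⟨1, le_rfl, .const x k s⟩
  | add x y z => exact ⟨1, le_rfl, .add x y z s⟩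
  | sub x y z => exact ⟨1, le_rfl, .sub x y z s⟩
  | load x a y => exact ⟨1, le_rfl, .load x a y s⟩
  | store a x y => exact ⟨1, le_rfl, .store a x y s⟩
  | seq c d ihc ihd =>
    simp only [loopFree, Bool.and_eq_true] at hc
    obtain ⟨t, ht, he⟩ := ihc hc.1 s
    obtain ⟨t', ht', he'⟩ := ihd hc.2 (c.eval s)
    exact ⟨t + t', add_le_add ht ht', he.seq he'⟩
  | cond x c d ihc ihd =>
    simp only [loopFree, Bool.and_eq_true] at hc
    by_cases hx : s.reg x = 0
    · obtain ⟨t, ht, he⟩ := ihd hc.2 s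
      refine ⟨t + 1, by simp [cost, ht], ?_⟩
      simpa [eval, hx] using Exec.cond_false hx he
    · obtain ⟨t, ht, he⟩ := ihc hc.1 s
      refine ⟨t + 1, by simp [cost, ht], ?_⟩
      simpa [eval, hx] using Exec.cond_true hx he
  | loop => simp [loopFree] at hc

/-- Symbolic execution of straight-line code: the goal becomes a statement about `eval`, which
`simp` can unfold, and the side conditions are settled by computation. -/
theorem WP.of_eval {c : Program} {s : Mem} {Q : Mem → Prop} {T : ℕ} (h : Q (c.eval s))
    (hc : c.loopFree = true := by rfl) (hT : c.cost ≤ T := by decide) : c.WP s T Q :=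
  let ⟨t, ht, he⟩ := exec_eval c hc s
  ⟨t, ht.trans hT, _, he, h⟩

/-- Repeat `c` with register `x` running through the numbers below the content of register `lim`.
Register `2` has to hold `1`, register `3` is used for the test. -/
def forLoop (x lim : ℕ) (c : Program) : Program :=
  .seq (.seq (.const x 0) (.sub 3 lim x))
    (.loop 3 (.seq c (.seq (.add x x 2) (.sub 3 lim x))))

/-- The registers of a `forLoop` are distinct, and its body does not interfere with them. -/
def forLoopOK (x lim : ℕ) (c : Program) : Bool :=
  x != 2 && x != 3 && x != lim && lim != 3 &&
    !c.writesReg x && !c.writesReg lim && !c.writesReg 2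

/-- The invariant speaks of the memory after the counter and the test register have been advanced.
The body may also use the frame of the whole loop relative to its start, so unwritten registers need
not appear in the invariant. Each round costs three extra steps (increment, subtraction, test); the
outer 3 covers initialization and the last test. -/
theorem WP.forLoop {x lim : ℕ} {c : Program} {s : Mem} {T L : ℕ} (I : ℕ → Mem → Prop)
    (h2 : s.reg 2 = 1) (hL : s.reg lim = L)
    (h0 : I 0 ((s.setReg x 0).setReg 3 L))
    (hstep : ∀ k < L, ∀ s', (forLoop x lim c).Frame s s' → s'.reg x = k → I k s' →
      c.WP s' T fun s'' => I (k + 1) ((s''.setReg x (k + 1)).setReg 3 (L - (k + 1))))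
    (hok : forLoopOK x lim c = true := by rfl) :
    (Program.forLoop x lim c).WP s (L * (T + 3) + 3) (I L) := by
  simp only [forLoopOK, Bool.and_eq_true, bne_iff_ne, Bool.not_eq_true'] at hok
  obtain ⟨⟨⟨⟨⟨⟨hx2, hx3⟩, hxl⟩, hl3⟩, hcx⟩, hcl⟩, hc2⟩ := hok
  -- Induction on the number `r` of remaining rounds, which is exactly the content of register 3.
  have key : ∀ r k s', r + k = L → (Program.forLoop x lim c).Frame s s' → s'.reg x = k →
      s'.reg 3 = r → s'.reg 2 = 1 → s'.reg lim = L → I k s' →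
      (Program.loop 3 (.seq c (.seq (.add x x 2) (.sub 3 lim x)))).WP s' (r * (T + 3) + 1) (I L) := by
    intro r
    induction r with
    | zero =>
      intro k s' hk _ _ h3 _ _ hI
      obtain rfl : k = L := by omega
      exact ⟨1, by simp, s', .loop_done h3, hI⟩
    | succ r ih =>
      intro k s' hk hfr hx h3 h2 hl hI
      obtain ⟨t, ht, s₁, he, hI₁⟩ := hstep k (by omega) s' hfr hx hI
      have e1 : s₁.reg x = k := by rw [he.frame.reg x hcx, hx]
      have e2 : s₁.reg 2 = 1 := by rw [he.frame.reg 2 hc2, h2]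
      have e3 : s₁.reg lim = L := by rw [he.frame.reg lim hcl, hl]
      have he2 : Exec (.seq c (.seq (.add x x 2) (.sub 3 lim x))) s' (t + (1 + 1))
          ((s₁.setReg x (k + 1)).setReg 3 (L - (k + 1))) := by
        refine he.seq ?_
        have h := Exec.seq (Exec.add x x 2 s₁) (Exec.sub 3 lim x _)
        simpa [e1, e2, e3, hxl.symm] using h
      have hfr2 : (Program.forLoop x lim c).Frame s ((s₁.setReg x (k + 1)).setReg 3 (L - (k + 1))) := by
        have := he2.frame
        constructor
        · intro y hy
          rw [← hfr.reg y hy]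
          exact this.reg y (by simp [Program.forLoop, writesReg] at hy ⊢; tauto)
        · intro y hy
          rw [← hfr.arr y hy]
          exact this.arr y (by simp [Program.forLoop, writesArr] at hy ⊢; tauto)
      obtain ⟨t', ht', s₂, he', hI₂⟩ := ih (k + 1) _ (by omega) hfr2 (by simp [hx3])
        (by simp; omega) (by simp [hx2.symm, e2]) (by simp [hl3, hxl.symm, e3]) hI₁
      refine ⟨t + (1 + 1) + t' + 1, by nlinarith, s₂, .loop_round (by omega) he2 he', hI₂⟩
  have he0 : Exec (.seq (.const x 0) (.sub 3 lim x)) s (1 + 1) ((s.setReg x 0).setReg 3 L) := by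
    have h := Exec.seq (Exec.const x 0 s) (Exec.sub 3 lim x _)
    simpa [hL, hxl.symm] using h
  have hfr : (Program.forLoop x lim c).Frame s ((s.setReg x 0).setReg 3 L) := by
    have := he0.frame
    constructor
    · intro y hy
      exact this.reg y (by simp [Program.forLoop, writesReg] at hy ⊢; tauto)
    · intro y hy
      exact this.arr y rfl
  obtain ⟨t, ht, s', he, hI⟩ := key L 0 _ (by omega) hfr (by simp [hx3]) (by simp)
    (by simp [hx2.symm, h2]) (by simp [hl3, hxl.symm, hL]) h0
  exact ⟨1 + 1 + t, by omega, s', he0.seq he, hI⟩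

end Program

namespace Market

/-! ### Optimal allocations are fair and efficient -/

variable {n m : ℕ} (I : Market n m)

theorem rank_le_of_pref {p : Fin m} {i j : Fin n} (h : I.pref p i j) : I.rank p i ≤ I.rank p j := by
  refine Nat.add_le_add_left (Set.ncard_le_ncard ?_ (Set.toFinite _)) 1
  rintro k ⟨hk, hk'⟩
  exact ⟨I.pref_trans _ _ _ _ hk h, fun h' => hk' (I.pref_trans _ _ _ _ h h')⟩

theorem rank_lt_of_strictPref {p : Fin m} {i j : Fin n} (h : I.strictPref p i j) :
    I.rank p i < I.rank p j := by
  refine Nat.add_lt_add_left (Set.ncard_lt_ncard ⟨?_, fun hs => ?_⟩ (Set.toFinite _)) 1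
  · rintro k ⟨hk, hk'⟩
    exact ⟨I.pref_trans _ _ _ _ hk h.1, fun h' => hk' (I.pref_trans _ _ _ _ h.1 h')⟩
  · have : I.strictPref p i i := hs h
    exact this.2 this.1

theorem rank_le (p : Fin m) (i : Fin n) : I.rank p i ≤ n := by
  have : Set.ncard {j | I.strictPref p j i} < n := by
    have h : Set.ncard {j | I.strictPref p j i} < (Set.univ : Set (Fin n)).ncard := by
      refine Set.ncard_lt_ncard ⟨Set.subset_univ _, fun hs => ?_⟩ (Set.toFinite _)
      have : I.strictPref p i i := hs (Set.mem_univ i)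
      exact this.2 this.1
    simpa [Set.ncard_univ] using h
  unfold rank
  omega

/-- The welfare of the teams. -/
def welfare (A : Allocation n m) : ℕ := ∏ i, (I.value i (A.part i) + 1)

/-- The sum of the ranks that the players give to their teams. -/
noncomputable def totalRank (A : Allocation n m) : ℕ := ∑ p, I.rank p (A p)

/-- `A` maximizes the welfare of the teams, and minimizes the total rank as a second criterion. -/
def Optimal (A : Allocation n m) : Prop :=
  ∀ A' : Allocation n m, I.welfare A' < I.welfare A ∨
    I.welfare A' = I.welfare A ∧ I.totalRank A ≤ I.totalRank A'

variable {I}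

/-- A gain of a team raises one factor of a product of positive factors; a gain of a player alone
leaves the product no smaller and lowers the total rank. -/
theorem Optimal.po {A : Allocation n m} (hA : I.Optimal A) : I.PO A := by
  rintro A' ⟨hv, hp, h⟩
  rcases hA A' with h1 | ⟨h1, h2⟩
  · exact absurd (Finset.prod_le_prod' fun i _ => Nat.add_le_add_right (hv i) 1) h1.not_ge
  · rcases h with ⟨i, hi⟩ | ⟨p, hp'⟩
    · refine absurd h1.symm (ne_of_lt ?_)
      exact Finset.prod_lt_prod (fun _ _ => Nat.succ_pos _)
        (fun i _ => Nat.add_le_add_right (hv i) 1) ⟨i, Finset.mem_univ i, Nat.add_lt_add_right hi 1⟩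
    · refine absurd h2 (not_le.2 ?_)
      exact Finset.sum_lt_sum (fun p _ => I.rank_le_of_pref (hp p))
        ⟨p, Finset.mem_univ p, I.rank_lt_of_strictPref hp'⟩

theorem part_update_self (A : Allocation n m) (g : Fin m) (i : Fin n) :
    Allocation.part (Function.update A g i) i = insert g (A.part i) := by
  ext p
  by_cases h : p = g <;> simp [Allocation.part, Function.update_apply, h]

theorem part_update_of_ne (A : Allocation n m) (g : Fin m) {i k : Fin n} (h : k ≠ i) :
    Allocation.part (Function.update A g i) k = (A.part k).erase g := by
  ext p
  by_cases hp : p = g <;> simp [Allocation.part, Function.update_apply, hp, h.symm]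

/-- Moving a player from team `j` to team `i` does not increase the welfare. -/
theorem Optimal.move_le {A : Allocation n m} (hA : I.Optimal A) {i j : Fin n} (hij : i ≠ j)
    {g : Fin m} (hg : A g = j) :
    I.v i g * (I.value j (A.part j) + 1) ≤
      I.v j g * (I.value i (A.part i) + 1 + I.v i g) := by
  set A' : Allocation n m := Function.update A g i
  have hle : I.welfare A' ≤ I.welfare A := by
    rcases hA A' with h | h
    · exact h.le
    · exact h.1.le
  have hi : I.value i (A'.part i) = I.value i (A.part i) + I.v i g := by
    rw [part_update_self, value, Finset.sum_insert, add_comm]; · rfl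
    simp [Allocation.part, hg, hij.symm]
  have hj : I.value j (A'.part j) + I.v j g = I.value j (A.part j) := by
    rw [part_update_of_ne _ _ hij.symm]
    exact Finset.sum_erase_add _ _ (by simp [Allocation.part, hg])
  have hk : ∀ k, k ≠ i → k ≠ j → I.value k (A'.part k) = I.value k (A.part k) := by
    intro k hki hkj
    rw [part_update_of_ne _ _ hki, Finset.erase_eq_of_notMem]
    simp [Allocation.part, hg, hkj.symm]
  have hji : j ∈ Finset.univ.erase i := by simp [hij.symm]
  have split : ∀ C : Allocation n m, I.welfare C = (I.value i (C.part i) + 1) *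
      ((I.value j (C.part j) + 1) *
        ∏ k ∈ (Finset.univ.erase i).erase j, (I.value k (C.part k) + 1)) := by
    intro C
    rw [Finset.mul_prod_erase _ (fun k => I.value k (C.part k) + 1) hji,
      Finset.mul_prod_erase _ (fun k => I.value k (C.part k) + 1) (Finset.mem_univ i)]
    rfl
  rw [split, split, ← mul_assoc, ← mul_assoc] at hle
  have hprod : ∏ k ∈ (Finset.univ.erase i).erase j, (I.value k (A'.part k) + 1) =
      ∏ k ∈ (Finset.univ.erase i).erase j, (I.value k (A.part k) + 1) := by
    refine Finset.prod_congr rfl fun k h => ?_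
    simp only [Finset.mem_erase] at h
    rw [hk k h.2.1 h.1]
  rw [hprod] at hle
  have := Nat.le_of_mul_le_mul_right hle (Finset.prod_pos fun _ _ => Nat.succ_pos _)
  -- Expressing the old value of `j` as the new one plus `I.v j g` avoids truncated subtraction.
  rw [hi, ← hj] at this
  rw [← hj]
  nlinarith

/-- If removing any `g` from `A_j` leaves envy, then vᵢ(Aᵢ) + 1 + vᵢ(g) ≤ vᵢ(A_j), so `move_le`
gives vᵢ(g)(v_j(A_j) + 1) ≤ v_j(g) vᵢ(A_j). Summing over `g` yields vᵢ(A_j)(v_j(A_j) + 1) ≤ v_j(A_j)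
vᵢ(A_j), impossible when vᵢ(A_j) > 0. -/
theorem Optimal.ef1 {A : Allocation n m} (hA : I.Optimal A) : I.EF1 A := by
  intro i j hij
  by_cases hex : ∃ g ∈ A.part j, I.value i (A.part j \ {g}) ≤ I.value i (A.part i)
  · obtain ⟨g, hg, h⟩ := hex
    exact ⟨∅, by simp, {g}, by simpa using hg, by simp, by simpa using h⟩
  push Not at hex
  by_cases hV : I.value i (A.part j) = 0
  · exact ⟨∅, by simp, ∅, by simp, by simp, by simp [hV]⟩
  exfalso
  have h : ∀ g ∈ A.part j,
      I.v i g * (I.value j (A.part j) + 1) ≤ I.v j g * I.value i (A.part j) := by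
    intro g hg
    have h1 := hA.move_le hij (g := g) (by simpa [Allocation.part] using hg)
    have h2 := hex g hg
    have h3 : I.value i (A.part j \ {g}) + I.v i g = I.value i (A.part j) := by
      rw [Finset.sdiff_singleton_eq_erase]
      exact Finset.sum_erase_add _ _ hg
    refine h1.trans (Nat.mul_le_mul_left _ ?_)
    omega
  have hsum := Finset.sum_le_sum h
  rw [← Finset.sum_mul, ← Finset.sum_mul] at hsum
  change I.value i (A.part j) * _ ≤ I.value j (A.part j) * _ at hsum
  nlinarith [Nat.pos_of_ne_zero hV]

theorem totalRank_le (A : Allocation n m) : I.totalRank A ≤ m * n := by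
  refine (Finset.sum_le_sum fun p _ => I.rank_le p (A p)).trans ?_
  simp

/-- A single score for both criteria. -/
theorem optimal_of_score_le {A : Allocation n m} {K : ℕ} (hK : m * n < K)
    (h : ∀ A' : Allocation n m, K * I.welfare A' + (K - I.totalRank A') ≤
      K * I.welfare A + (K - I.totalRank A)) : I.Optimal A := by
  intro A'
  have h0 := h A'
  have h1 := totalRank_le (I := I) A
  have h2 := totalRank_le (I := I) A'
  rcases lt_trichotomy (I.welfare A') (I.welfare A) with hlt | heq | hgt
  · exact Or.inl hlt
  · rw [heq] at h0
    exact Or.inr ⟨heq, by omega⟩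
  · exfalso
    -- One unit of welfare is worth `K`, while the rank term lies between 1 and `K`; it is never 0,
    -- so the comparison is strict.
    have hmul : K * (I.welfare A + 1) ≤ K * I.welfare A' := Nat.mul_le_mul_left _ hgt
    rw [mul_add, mul_one] at hmul
    have hr : 1 ≤ K - I.totalRank A' := by omega
    have hr' : K - I.totalRank A ≤ K := Nat.sub_le _ _
    omega

end Market

/-! ### Maximization by a scan, and dynamic programming -/

/-- The maximum of `f` below `L` and the first number where it is attained (`0` and `0` if `f`
vanishes below `L`). -/
def scan (f : ℕ → ℕ) : ℕ → ℕ × ℕ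
  | 0 => (0, 0)
  | L + 1 => if (scan f L).1 < f L then (f L, L) else scan f L

theorem le_scan (f : ℕ → ℕ) {L i : ℕ} (hi : i < L) : f i ≤ (scan f L).1 := by
  induction L with
  | zero => omega
  | succ L ih =>
    rw [scan]
    rcases Nat.lt_succ_iff_lt_or_eq.1 hi with h | rfl
    · have := ih h
      split_ifs
      · exact this.trans (by omega)
      · exact this
    · split_ifs <;> omega

theorem scan_snd_lt (f : ℕ → ℕ) {L : ℕ} (hL : 0 < L) : (scan f L).2 < L := by
  induction L with
  | zero => omega
  | succ L ih =>
    rw [scan]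
    split_ifs
    · exact Nat.lt_succ_self L
    · rcases Nat.eq_zero_or_pos L with rfl | h
      · simp [scan]
      · exact (ih h).trans (Nat.lt_succ_self L)

theorem apply_scan_snd (f : ℕ → ℕ) {L : ℕ} (h : (scan f L).1 ≠ 0) :
    f (scan f L).2 = (scan f L).1 := by
  induction L with
  | zero => simp [scan] at h
  | succ L ih =>
    rw [scan] at h ⊢
    split_ifs at h ⊢ with h'
    · rfl
    · exact ih h

/-! ### Correctness of the dynamic program. -/

section Layers

/-- Extending a table by one player: the player weighs `d i` and costs `r i` in team `i`. -/
def extend (n : ℕ) (d r D : ℕ → ℕ) (y : ℕ) : ℕ × ℕ :=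
  scan (fun i => if d i ≤ y then D (y - d i) - r i else 0) n

/-- `layer n d r K k y` is `K` minus the least total cost of the assignments of the first `k` players
to `n` teams with total weight `y` (and `0` if there is no such assignment). -/
def layer (n : ℕ) (d r : ℕ → ℕ → ℕ) (K : ℕ) : ℕ → ℕ → ℕ
  | 0, y => if y = 0 then K else 0
  | k + 1, y => (extend n (d k) (r k) (layer n d r K k) y).1

/-- The team of player `k` in an assignment that attains `layer n d r K (k + 1) y`. -/
def choice (n : ℕ) (d r : ℕ → ℕ → ℕ) (K k y : ℕ) : ℕ :=
  (extend n (d k) (r k) (layer n d r K k) y).2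

/-- An assignment that attains `layer n d r K k y`. -/
def assign (n : ℕ) (d r : ℕ → ℕ → ℕ) (K : ℕ) : ℕ → ℕ → ℕ → ℕ
  | 0, _, _ => 0
  | k + 1, y, p =>
    if p = k then choice n d r K k y else assign n d r K k (y - d k (choice n d r K k y)) p

variable {n : ℕ} {d r : ℕ → ℕ → ℕ} {K : ℕ}

theorem choice_lt (hn : 0 < n) (k y : ℕ) : choice n d r K k y < n := scan_snd_lt _ hn

theorem assign_lt (hn : 0 < n) (k y p : ℕ) : assign n d r K k y p < n := by
  induction k generalizing y with
  | zero => exact hn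
  | succ k ih =>
    rw [assign]
    split_ifs
    · exact choice_lt hn k y
    · exact ih _

/-- Truncation is harmless here: subtracting the costs one by one from `K` and stopping at 0 gives
the same as subtracting their sum. -/
theorem le_layer (A : ℕ → ℕ) (k : ℕ) (hA : ∀ p < k, A p < n) :
    K - ∑ p ∈ Finset.range k, r p (A p) ≤
      layer n d r K k (∑ p ∈ Finset.range k, d p (A p)) := by
  induction k with
  | zero => simp [layer]
  | succ k ih =>
    have h1 := ih fun p hp => hA p (by omega)
    have h2 := le_scan (fun i => if d k i ≤ ∑ p ∈ Finset.range (k + 1), d p (A p) then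
      layer n d r K k ((∑ p ∈ Finset.range (k + 1), d p (A p)) - d k i) - r k i else 0)
      (hA k (Nat.lt_succ_self k))
    refine le_trans ?_ h2
    simp only [Finset.sum_range_succ, Nat.le_add_left, if_true, Nat.add_sub_cancel]
    omega

/-- A nonzero entry forces the entry it came from to be nonzero as well, so the backward trace stays
on reachable indices down to the index 0 of the empty assignment. -/
theorem layer_assign (k y : ℕ) (h : layer n d r K k y ≠ 0) :
    ∑ p ∈ Finset.range k, d p (assign n d r K k y p) = y ∧
      layer n d r K k y = K - ∑ p ∈ Finset.range k, r p (assign n d r K k y p) := by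
  induction k generalizing y with
  | zero =>
    have hy : y = 0 := by
      by_contra hy
      simp [layer, hy] at h
    simp [layer, hy]
  | succ k ih =>
    have h1 := apply_scan_snd (L := n) (fun i => if d k i ≤ y then
      layer n d r K k (y - d k i) - r k i else 0) h
    change (if d k (choice n d r K k y) ≤ y then
      layer n d r K k (y - d k (choice n d r K k y)) - r k (choice n d r K k y) else 0) =
        layer n d r K (k + 1) y at h1
    split_ifs at h1 with hd
    · obtain ⟨h2, h3⟩ := ih (y - d k (choice n d r K k y)) (by omega)
      have e : ∀ f : ℕ → ℕ → ℕ, ∑ p ∈ Finset.range (k + 1), f p (assign n d r K (k + 1) y p) =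
          (∑ p ∈ Finset.range k,
            f p (assign n d r K k (y - d k (choice n d r K k y)) p)) +
              f k (choice n d r K k y) := by
        intro f
        rw [Finset.sum_range_succ]
        congr 1
        · refine Finset.sum_congr rfl fun p hp => ?_
          rw [assign, if_neg (Finset.mem_range.1 hp).ne]
        · rw [assign, if_pos rfl]
      rw [e, e]
      omega
    · exact absurd h1.symm h

end Layers

/-! ### Mixed radix indices -/

/-- A table of `K` times the product of the digits plus `1` of numbers with `i` digits. -/
def prodTable (B K : ℕ) : ℕ → ℕ → ℕ
  | 0, _ => K
  | i + 1, x => prodTable B K i (x % B ^ i) * (x / B ^ i + 1)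

theorem sum_digits_lt {B : ℕ} (u : ℕ → ℕ) (n : ℕ) (hu : ∀ i < n, u i < B) :
    ∑ i ∈ Finset.range n, u i * B ^ i < B ^ n := by
  induction n with
  | zero => simp
  | succ n ih =>
    rw [Finset.sum_range_succ, pow_succ]
    have h1 := ih fun i hi => hu i (by omega)
    have h2 := Nat.mul_le_mul_right (B ^ n) (Nat.succ_le_of_lt (hu n (Nat.lt_succ_self n)))
    rw [Nat.succ_mul, mul_comm B] at h2
    omega

theorem prodTable_sum_digits {B : ℕ} (K : ℕ) (u : ℕ → ℕ) (n : ℕ) (hu : ∀ i < n, u i < B) :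
    prodTable B K n (∑ i ∈ Finset.range n, u i * B ^ i) =
      K * ∏ i ∈ Finset.range n, (u i + 1) := by
  induction n with
  | zero => simp [prodTable]
  | succ n ih =>
    have h1 := ih fun i hi => hu i (by omega)
    have h2 := sum_digits_lt u n fun i hi => hu i (by omega)
    rw [Finset.sum_range_succ, Finset.prod_range_succ, prodTable, Nat.add_mul_mod_self_right,
      Nat.mod_eq_of_lt h2, Nat.add_mul_div_right _ _ (by omega), Nat.div_eq_of_lt h2, h1]
    ring

/-- As a function of the leading digit the table is linear, so each block of cells is the previous
block plus block 0. This is how the table is filled without multiplication. -/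
theorem prodTable_add (B K i : ℕ) {dg x : ℕ} (hB : 0 < B) (hx : x < B ^ i) :
    prodTable B K (i + 1) ((dg + 1) * B ^ i + x) =
      prodTable B K (i + 1) (dg * B ^ i + x) + prodTable B K (i + 1) x := by
  have h : ∀ e, prodTable B K (i + 1) (e * B ^ i + x) = prodTable B K i x * (e + 1) := by
    intro e
    rw [prodTable, add_comm, Nat.add_mul_mod_self_right, Nat.mod_eq_of_lt hx,
      Nat.add_mul_div_right _ _ (by positivity), Nat.div_eq_of_lt hx, zero_add]
  have h0 := h 0
  simp only [zero_mul, zero_add, mul_one] at h0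
  rw [h, h, h0]
  ring

theorem prodTable_succ_of_lt (B K i : ℕ) {x : ℕ} (hx : x < B ^ i) :
    prodTable B K (i + 1) x = prodTable B K i x := by
  rw [prodTable, Nat.mod_eq_of_lt hx, Nat.div_eq_of_lt hx, zero_add, mul_one]

/-! ### The allocation found by dynamic programming -/

namespace Market

variable {n m : ℕ} (I : Market n m)

/-- The contents of array `0` at the beginning. -/
def valueArr : ℕ → ℕ := tableArr fun p i => I.v i p

/-- The contents of array `1` at the beginning. -/
noncomputable def rankArr : ℕ → ℕ := tableArr I.rank

/-- A number greater than the value of each team for each set of players. -/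
def base : ℕ := 1 + ∑ a ∈ Finset.range (m * n), I.valueArr a

/-- A number greater than the total rank of each allocation. -/
def bigNumber (_ : Market n m) : ℕ := m * n + 1

/-- The value of team `i` for player `p` as a number with the digit at position `i`. -/
def weight (p i : ℕ) : ℕ := I.valueArr (p * n + i) * I.base ^ i

/-- The table of the dynamic program. -/
noncomputable def table (k y : ℕ) : ℕ :=
  layer n I.weight (fun p i => I.rankArr (p * n + i)) I.bigNumber k y

/-- The combined score of an index, `0` if no allocation has this index. -/
noncomputable def score (y : ℕ) : ℕ :=
  if I.table m y = 0 then 0 else prodTable I.base I.bigNumber n y + I.table m y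

/-- An index with the greatest score. -/
noncomputable def bestIndex : ℕ := (scan I.score (I.base ^ n)).2

/-- The assignment found by the dynamic program. -/
noncomputable def bestAssign (p : ℕ) : ℕ :=
  assign n I.weight (fun p i => I.rankArr (p * n + i)) I.bigNumber m I.bestIndex p

variable {I}

theorem tableArr_apply (f : Fin m → Fin n → ℕ) (p : Fin m) (i : Fin n) :
    tableArr f (p * n + i) = f p i := by
  have h : (p : ℕ) * n + i < m * n := by
    have h1 : ((p : ℕ) + 1) * n ≤ m * n := Nat.mul_le_mul_right _ p.2
    have := i.2
    rw [Nat.succ_mul] at h1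
    omega
  have hn : 0 < n := i.pos
  rw [tableArr, dif_pos h]
  congr 1
  · ext
    simp only [Fin.coe_divNat]
    rw [add_comm, Nat.add_mul_div_right _ _ hn, Nat.div_eq_of_lt i.2, zero_add]
  · ext
    simp only [Fin.coe_modNat]
    rw [add_comm, Nat.add_mul_mod_self_right, Nat.mod_eq_of_lt i.2]

/-- This bound rules out carries between digits, so an index determines the value of every team. -/
theorem value_lt_base (i : Fin n) (S : Finset (Fin m)) : I.value i S < I.base := by
  rw [base, add_comm, Nat.lt_succ_iff]
  have hinj : Set.InjOn (fun p : Fin m => (p : ℕ) * n + i) S := by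
    intro p _ q _ h
    have h' : (p : ℕ) * n = q * n := Nat.add_right_cancel h
    exact Fin.ext (Nat.eq_of_mul_eq_mul_right i.pos h')
  calc I.value i S = ∑ p ∈ S, I.valueArr ((p : ℕ) * n + i) :=
        Finset.sum_congr rfl fun p _ => (tableArr_apply (fun p i => I.v i p) p i).symm
    _ = ∑ a ∈ S.image (fun p : Fin m => (p : ℕ) * n + i), I.valueArr a :=
        (Finset.sum_image hinj).symm
    _ ≤ _ := by
        refine Finset.sum_le_sum_of_subset fun a ha => ?_
        obtain ⟨p, _, rfl⟩ := Finset.mem_image.1 ha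
        have h1 : ((p : ℕ) + 1) * n ≤ m * n := Nat.mul_le_mul_right _ p.2
        rw [Nat.succ_mul] at h1
        have := i.2
        simp only [Finset.mem_range]
        omega

/-- The index of the vector of the values of the teams. -/
def index (I : Market n m) (A : Allocation n m) : ℕ :=
  ∑ i : Fin n, I.value i (A.part i) * I.base ^ (i : ℕ)

theorem sum_weight (A : Allocation n m) : ∑ p : Fin m, I.weight p (A p) = I.index A := by
  rw [← Finset.sum_fiberwise Finset.univ A, index]
  refine Finset.sum_congr rfl fun i _ => ?_
  rw [value, Finset.sum_mul]
  refine Finset.sum_congr rfl fun p hp => ?_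
  obtain rfl : A p = i := by simpa [Allocation.part] using hp
  rw [weight, valueArr, tableArr_apply]

/-- The digits of `index`. -/
theorem index_lt_and_prodTable_index (A : Allocation n m) :
    I.index A < I.base ^ n ∧
      prodTable I.base I.bigNumber n (I.index A) = I.bigNumber * I.welfare A := by
  set u : ℕ → ℕ := fun i => if h : i < n then I.value ⟨i, h⟩ (A.part ⟨i, h⟩) else 0 with hu
  have hlt : ∀ i < n, u i < I.base := by
    intro i hi
    simp only [hu, hi, dif_pos]
    exact value_lt_base _ _
  have hidx : I.index A = ∑ i ∈ Finset.range n, u i * I.base ^ i := by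
    rw [← Fin.sum_univ_eq_sum_range (fun i => u i * I.base ^ i), index]
    simp [hu]
  have hw : I.welfare A = ∏ i ∈ Finset.range n, (u i + 1) := by
    rw [← Fin.prod_univ_eq_prod_range (fun i => u i + 1), welfare]
    simp [hu]
  rw [hidx, hw]
  exact ⟨sum_digits_lt u n hlt, prodTable_sum_digits _ u n hlt⟩

theorem le_table (A : Allocation n m) : I.bigNumber - I.totalRank A ≤ I.table m (I.index A) := by
  have h := le_layer (n := n) (d := I.weight) (r := fun p i => I.rankArr (p * n + i))
    (K := I.bigNumber) (fun p => if h : p < m then (A ⟨p, h⟩ : ℕ) else 0) m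
    (by intro p hp; simp [hp])
  rw [← Fin.sum_univ_eq_sum_range
      (fun p => I.weight p (if h : p < m then (A ⟨p, h⟩ : ℕ) else 0)),
    ← Fin.sum_univ_eq_sum_range
      (fun p => I.rankArr (p * n + (if h : p < m then (A ⟨p, h⟩ : ℕ) else 0)))] at h
  simp only [Fin.is_lt, dif_pos, Fin.eta] at h
  rw [sum_weight] at h
  refine le_trans (le_of_eq ?_) h
  rw [totalRank]
  congr 1
  exact Finset.sum_congr rfl fun p _ => (tableArr_apply I.rank p (A p)).symm

theorem le_score (A : Allocation n m) :
    I.bigNumber * I.welfare A + (I.bigNumber - I.totalRank A) ≤ I.score (I.index A) := by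
  have h1 := le_table (I := I) A
  have h2 := totalRank_le (I := I) A
  rw [score, (index_lt_and_prodTable_index A).2, if_neg]
  · omega
  · have : I.bigNumber = m * n + 1 := rfl
    omega

variable (I) in
/-- The allocation found by the dynamic program. -/
noncomputable def bestAllocation (hn : 0 < n) : Allocation n m :=
  fun p => ⟨I.bestAssign p, assign_lt hn _ _ _⟩

/-- Every allocation scores at most the maximum of the scan, which is therefore positive. Hence the
table entry at the best index is nonzero, and the allocation traced back from it has exactly this
index and this rank term, so it attains the maximum. -/
theorem optimal_bestAllocation (hn : 0 < n) : I.Optimal (I.bestAllocation hn) := by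
  have hle : ∀ A : Allocation n m, I.bigNumber * I.welfare A + (I.bigNumber - I.totalRank A) ≤
      (scan I.score (I.base ^ n)).1 := fun A =>
    (le_score A).trans (le_scan _ (index_lt_and_prodTable_index A).1)
  have hpos : (scan I.score (I.base ^ n)).1 ≠ 0 := by
    have h1 := hle (I.bestAllocation hn)
    have h2 := totalRank_le (I := I) (I.bestAllocation hn)
    have h3 : I.bigNumber = m * n + 1 := rfl
    omega
  have hbest := apply_scan_snd _ hpos
  change I.score I.bestIndex = _ at hbest
  have htab : I.table m I.bestIndex ≠ 0 := by
    intro h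
    rw [score, if_pos h] at hbest
    exact hpos hbest.symm
  obtain ⟨h1, h2⟩ := layer_assign m I.bestIndex htab
  have hidx : I.index (I.bestAllocation hn) = I.bestIndex := by
    rw [← sum_weight, ← h1]
    exact Fin.sum_univ_eq_sum_range (fun p => I.weight p (I.bestAssign p)) m
  have hrank : I.table m I.bestIndex = I.bigNumber - I.totalRank (I.bestAllocation hn) := by
    rw [table, h2, totalRank]
    congr 1
    refine Eq.trans (Fin.sum_univ_eq_sum_range
      (fun p => I.rankArr (p * n + I.bestAssign p)) m).symm ?_
    exact Finset.sum_congr rfl fun p _ => tableArr_apply I.rank p (I.bestAllocation hn p)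
  refine optimal_of_score_le (K := I.bigNumber) (Nat.lt_succ_self _) fun A => ?_
  refine (hle A).trans (le_of_eq ?_)
  rw [← hbest, score, if_neg htab, hrank, ← hidx, (index_lt_and_prodTable_index _).2]

end Market

/-! ### The program -/

infixr:60 " ;; " => Program.seq

namespace Program

theorem WP.step {c d : Program} {s : Mem} {T T' : ℕ} {Q : Mem → Prop} (h : d.WP (c.eval s) T' Q)
    (hc : c.loopFree = true := by rfl) (hT : c.cost ≤ T := by decide) :
    (c ;; d).WP s (T + T') Q := by
  obtain ⟨t, ht, he⟩ := exec_eval c hc s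
  obtain ⟨t', ht', s', he', hq⟩ := h
  exact ⟨t + t', by omega, s', he.seq he', hq⟩

/-- Put `n * m` into register `5`, one plus the sum of all values into register `4`, and
`n * m + 1` into register `6`. -/
def prepare : Program :=
  .const 2 1 ;;
  forLoop 14 1 (.add 5 5 0) ;;
  .add 4 4 2 ;;
  forLoop 8 5 (.load 12 0 8 ;; .add 4 4 12) ;;
  .add 6 5 2

theorem wp_prepare {n m : ℕ} {V : ℕ → ℕ} {s : Mem} (h0 : s.reg 0 = n) (h1 : s.reg 1 = m)
    (h4 : s.reg 4 = 0) (h5 : s.reg 5 = 0) (hV : s.arr 0 = V) :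
    prepare.WP s (4 * m + 5 * (m * n) + 9) fun s' => s'.reg 2 = 1 ∧
      s'.reg 4 = 1 + ∑ a ∈ Finset.range (m * n), V a ∧ s'.reg 6 = m * n + 1 := by
  have hloop₁ : (forLoop 14 1 (.add 5 5 0)).WP (s.setReg 2 1) (m * (1 + 3) + 3)
      fun s' => s'.reg 5 = m * n := by
    refine WP.forLoop (fun k s' => s'.reg 5 = k * n) (by simp) (by simp [h1]) (by simp [h5]) ?_
    intro k _ s' hf _ hI
    have e0 : s'.reg 0 = n := by rw [hf.reg 0 rfl]; simp [h0]
    refine WP.of_eval ?_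
    simp [eval, e0, hI, Nat.succ_mul]
  refine WP.mono (WP.step (T := 1) (WP.seq hloop₁ fun s₁ hf hs₁ => WP.step (T := 1)
    (WP.seq (Q' := fun s' => s'.reg 4 = 1 + ∑ a ∈ Finset.range (m * n), V a)
      (WP.forLoop (T := 2) (L := m * n)
        (fun k s' => s'.reg 4 = 1 + ∑ a ∈ Finset.range k, V a) ?_ ?_ ?_ ?_)
      fun s₂ hf₂ hs₂ => WP.of_eval (T := 1) ?_))) (by omega) fun _ _ h => h
  · have e2 : s₁.reg 2 = 1 := by rw [hf.reg 2 rfl]; simp [eval]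
    simp [eval, e2]
  · simp [eval, hs₁]
  · have e2 : s₁.reg 2 = 1 := by rw [hf.reg 2 rfl]; simp [eval]
    have e4 : s₁.reg 4 = 0 := by rw [hf.reg 4 rfl]; simp [eval, h4]
    simp [eval, e2, e4]
  · intro k _ s' hf' hk hI
    have eV : s'.arr 0 = V := by
      rw [hf'.arr 0 rfl]
      change s₁.arr 0 = V
      rw [hf.arr 0 rfl]
      exact hV
    refine WP.of_eval ?_
    simp [eval, eV, hI, hk, Finset.sum_range_succ, add_assoc]
  · have e2 : s₂.reg 2 = 1 := by
      rw [hf₂.reg 2 rfl]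
      simp only [eval, Mem.reg_setReg]
      rw [hf.reg 2 rfl]
      simp [eval]
    have e5 : s₂.reg 5 = m * n := by
      rw [hf₂.reg 5 rfl]
      simp [eval, hs₁]
    simp [eval, e2, e5, hs₂]

/-- Fill array `3` with the powers of register `4`, array `4` with the table `prodTable`, and
put the size of this table into register `7`. -/
def fillTables : Program :=
  (.const 7 1 ;; .store 4 17 6 ;; .sub 16 4 2) ;;
  forLoop 8 0
    ((.store 3 8 7 ;; .add 11 7 17) ;;
      forLoop 9 16 (forLoop 10 7
        (.sub 12 11 7 ;; .load 12 4 12 ;; .load 13 4 10 ;; .add 12 12 13 ;; .store 4 11 12 ;;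
          .add 11 11 2)) ;;
      .add 7 11 17)

/-- In round `i` register 7 holds `B ^ i`, the current block length, and register 11 the next free
cell. Register 17 stays 0, so that adding it copies a register. -/
theorem wp_fillTables {n B K : ℕ} {s : Mem} (hB : 0 < B) (h0 : s.reg 0 = n) (h2 : s.reg 2 = 1)
    (h4 : s.reg 4 = B) (h6 : s.reg 6 = K) (h17 : s.reg 17 = 0) :
    fillTables.WP s (n * (B * (9 * B ^ n + 6) + 9) + 6) fun s' => s'.reg 7 = B ^ n ∧
      (∀ i < n, s'.arr 3 i = B ^ i) ∧ ∀ x < B ^ n, s'.arr 4 x = prodTable B K n x := by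
  refine WP.mono (WP.step (T := 3) (WP.forLoop (T := B * (9 * B ^ n + 6) + 6) (L := n)
    (fun i s' => s'.reg 7 = B ^ i ∧ (∀ j < i, s'.arr 3 j = B ^ j) ∧
      ∀ x < B ^ i, s'.arr 4 x = prodTable B K i x) ?_ ?_ ?_ ?_)) (by ring_nf; omega) fun _ _ h => h
  · simp [eval, h2]
  · simp [eval, h0]
  · simp [eval, h17, h6, prodTable]
  · rintro i hi s₁ hf hx ⟨hI7, hI3, hI4⟩
    have e2 : s₁.reg 2 = 1 := by rw [hf.reg 2 rfl]; simp [eval, h2]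
    have e16 : s₁.reg 16 = B - 1 := by rw [hf.reg 16 rfl]; simp [eval, h2, h4]
    have e17 : s₁.reg 17 = 0 := by rw [hf.reg 17 rfl]; simp [eval, h17]
    have hW : B ^ i ≤ B ^ n := Nat.pow_le_pow_right hB hi.le
    have hW0 : 0 < B ^ i := by positivity
    refine WP.mono (WP.step (T := 2) (WP.seq (Q' := fun s' => s'.reg 11 = B ^ (i + 1) ∧
      ∀ x < B ^ (i + 1), s'.arr 4 x = prodTable B K (i + 1) x)
      (T₁ := (B - 1) * ((B ^ i * (6 + 3) + 3) + 3) + 3) ?_ fun s₂ hf₂ hs₂ =>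
        WP.of_eval (T := 1) ?_)) ?_ fun _ _ h => h
    -- Digit 0 is already in place, since the old table is block 0 of the new one; this leaves `B -
    -- 1` blocks.
    · refine WP.mono (WP.forLoop (L := B - 1) (fun dg s' => s'.reg 11 = (dg + 1) * B ^ i ∧
        ∀ x < (dg + 1) * B ^ i, s'.arr 4 x = prodTable B K (i + 1) x) ?_ ?_ ?_ ?_) le_rfl ?_
      · simp [eval, e2]
      · simp [eval, e16]
      · refine ⟨by simp [eval, e17, hI7], fun x hx => ?_⟩
        rw [zero_add, one_mul] at hx
        simp [eval, hI4 x hx, prodTable_succ_of_lt B K i hx]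
      · rintro dg hdg s₂ hf₂ hx₂ ⟨hJ11, hJ4⟩
        have e2' : s₂.reg 2 = 1 := by rw [hf₂.reg 2 rfl]; simp [eval, e2]
        have e7' : s₂.reg 7 = B ^ i := by rw [hf₂.reg 7 rfl]; simp [eval, hI7]
        refine WP.mono (WP.forLoop (L := B ^ i) (T := 6)
          (fun r s' => s'.reg 11 = (dg + 1) * B ^ i + r ∧
          ∀ x < (dg + 1) * B ^ i + r, s'.arr 4 x = prodTable B K (i + 1) x) ?_ ?_ ?_ ?_) le_rfl ?_
        · simp [e2']
        · simp [e7']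
        · simpa using ⟨hJ11, hJ4⟩
        · rintro r hr s₃ hf₃ hx₃ ⟨hL11, hL4⟩
          have e2'' : s₃.reg 2 = 1 := by rw [hf₃.reg 2 rfl, e2']
          have e7'' : s₃.reg 7 = B ^ i := by rw [hf₃.reg 7 rfl, e7']
          have hsub : (dg + 1) * B ^ i + r - B ^ i = dg * B ^ i + r := by
            rw [Nat.succ_mul]; omega
          have hle : B ^ i ≤ (dg + 1) * B ^ i := Nat.le_mul_of_pos_left _ (Nat.succ_pos _)
          refine WP.of_eval ?_
          simp only [eval, Mem.reg_setReg, Mem.arr_setReg, Mem.reg_setArr, Mem.arr_setArr_self]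
          norm_num
          refine ⟨by rw [hL11, e2'']; rfl, fun x hx => ?_⟩
          rw [hL11, e7'', hx₃, hsub, hL4 _ (by rw [Nat.succ_mul]; omega), hL4 r (by omega)]
          split_ifs with h
          · rw [h, prodTable_add B K i hB hr]
          · exact hL4 x (by omega)
        · rintro s' _ ⟨hs11, hs4⟩
          have e : (dg + 1) * B ^ i + B ^ i = (dg + 1 + 1) * B ^ i := by ring
          rw [e] at hs11 hs4
          exact ⟨by simpa using hs11, fun x hx => by simpa using hs4 x hx⟩
      · rintro s' _ ⟨hs11, hs4⟩
        have e : (B - 1 + 1) * B ^ i = B ^ (i + 1) := by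
          rw [Nat.sub_add_cancel hB, pow_succ, mul_comm]
        rw [e] at hs11 hs4
        exact ⟨hs11, hs4⟩
    · have e17' : s₂.reg 17 = 0 := by rw [hf₂.reg 17 rfl]; simp [eval, e17]
      have e3' : s₂.arr 3 = Function.update (s₁.arr 3) i (B ^ i) := by
        rw [hf₂.arr 3 rfl]; simp [eval, Mem.arr_setArr, hx, hI7]
      refine ⟨by simp [eval, hs₂.1, e17'], fun j hj => ?_, by simpa [eval] using hs₂.2⟩
      simp only [eval, Mem.arr_setReg, e3', Function.update_apply]
      split_ifs with h
      · rw [h]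
      · exact hI3 j (by omega)
    · have h1 : (B - 1) * ((B ^ i * (6 + 3) + 3) + 3) ≤ B * (9 * B ^ n + 6) :=
        Nat.mul_le_mul (Nat.sub_le _ _) (by omega)
      omega

/-- Fill array `5` with the weights of the players in the teams. -/
def fillWeights : Program :=
  forLoop 14 1 (forLoop 8 0
    ((.load 12 0 18 ;; .load 13 3 8 ;; .const 19 0) ;;
      forLoop 9 12 (.add 19 19 13) ;;
      (.store 5 18 19 ;; .add 18 18 2)))

/-- Each weight is a sum of `V a` copies of a power of `B`; the hypothesis `hVB` bounds the length
of this loop. -/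
theorem wp_fillWeights {n m B : ℕ} {V : ℕ → ℕ} {s : Mem} (hVB : ∀ a, V a ≤ B)
    (h0 : s.reg 0 = n) (h1 : s.reg 1 = m) (h2 : s.reg 2 = 1) (h18 : s.reg 18 = 0)
    (hV : s.arr 0 = V) (h3 : ∀ i < n, s.arr 3 i = B ^ i) :
    fillWeights.WP s (m * (n * (4 * B + 11) + 6) + 3) fun s' => s'.reg 18 = m * n ∧
      ∀ a < m * n, s'.arr 5 a = V a * B ^ (a % n) := by
  refine WP.mono (WP.forLoop (T := n * (4 * B + 11) + 3) (L := m)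
    (fun p s' => s'.reg 18 = p * n ∧ ∀ a < p * n, s'.arr 5 a = V a * B ^ (a % n)) ?_ ?_ ?_ ?_)
    (by ring_nf; omega) fun _ _ h => h
  · simp [h2]
  · simp [h1]
  · simp [h18]
  · rintro p hp s₁ hf hx hI
    refine WP.mono (WP.forLoop (T := 4 * B + 8) (L := n)
      (fun i s' => s'.reg 18 = p * n + i ∧ ∀ a < p * n + i, s'.arr 5 a = V a * B ^ (a % n))
      ?_ ?_ ?_ ?_) (by ring_nf; omega) ?_
    · rw [hf.reg 2 rfl, h2]
    · rw [hf.reg 0 rfl, h0]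
    · simpa using hI
    · rintro i hi s₂ hf₂ hx₂ ⟨hJ18, hJ5⟩
      have e2 : s₂.reg 2 = 1 := by rw [hf₂.reg 2 rfl, hf.reg 2 rfl, h2]
      have eV : s₂.arr 0 = V := by rw [hf₂.arr 0 rfl, hf.arr 0 rfl, hV]
      have e3 : s₂.arr 3 i = B ^ i := by rw [hf₂.arr 3 rfl, hf.arr 3 rfl, h3 i hi]
      refine WP.mono (WP.step (T := 3) (WP.seq (WP.forLoop (T := 1) (L := V (p * n + i))
        (fun k s' => s'.reg 19 = k * B ^ i) ?_ ?_ ?_ ?_) fun s₃ hf₃ hs₃ =>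
        WP.of_eval (T := 2) ?_)) ?_ fun _ _ h => h
      · simp [eval, e2]
      · simp [eval, eV, hJ18]
      · simp [eval]
      · intro k _ s₃ hf₃ _ hL
        have e13 : s₃.reg 13 = B ^ i := by rw [hf₃.reg 13 rfl]; simp [eval, hx₂, e3]
        refine WP.of_eval ?_
        simp [eval, hL, e13, Nat.succ_mul]
      · have e2' : s₃.reg 2 = 1 := by rw [hf₃.reg 2 rfl]; simp [eval, e2]
        have e18' : s₃.reg 18 = p * n + i := by rw [hf₃.reg 18 rfl]; simp [eval, hJ18]
        have e5' : s₃.arr 5 = s₂.arr 5 := by rw [hf₃.arr 5 rfl]; simp [eval]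
        refine ⟨by simp [eval, e18', e2', add_assoc], fun a ha => ?_⟩
        simp only [eval, Mem.arr_setReg, Mem.arr_setArr_self, e18', hs₃, e5']
        split_ifs with h
        · rw [h, Nat.mul_add_mod_self_right, Nat.mod_eq_of_lt hi]
        · exact hJ5 a (by omega)
      · have := hVB (p * n + i)
        omega
    · rintro s' _ ⟨hs18, hs5⟩
      have e : p * n + n = (p + 1) * n := by ring
      rw [e] at hs18 hs5
      exact ⟨by simpa using hs18, fun x hx => by simpa using hs5 x hx⟩

/-- The dynamic program: write `layer k y` into cell `k * S + y` of array `6` and `choice k y` into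
cell `k * S + y` of array `7`, where `S` is the content of register `7`. -/
def fillLayers : Program :=
  (.const 18 0 ;; .const 20 0 ;; .store 6 17 6) ;;
  forLoop 14 1
    (.add 21 20 7 ;;
      forLoop 15 7
        ((.const 22 0 ;; .const 23 0) ;;
          forLoop 8 0
            (.add 12 18 8 ;; .load 13 5 12 ;; .load 19 1 12 ;; .add 24 15 2 ;; .sub 24 24 13 ;;
              .cond 24 (.sub 24 15 13 ;; .add 24 24 20 ;; .load 24 6 24 ;; .sub 24 24 19)
                (.const 24 0) ;;
              .sub 25 24 22 ;;
              .cond 25 (.add 22 24 17 ;; .add 23 8 17) (.const 25 0)) ;;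
          (.add 24 21 15 ;; .store 6 24 22 ;; .add 24 20 15 ;; .store 7 24 23)) ;;
      (.add 18 18 0 ;; .add 20 21 17))

/-- Registers 18, 20 and 21 carry `k * n`, `k * S` and `(k + 1) * S` along by addition. Registers 22
and 23 hold the running maximum and its position, that is, the pair computed by `scan`. -/
theorem wp_fillLayers {n m S K : ℕ} {d r : ℕ → ℕ → ℕ} {s : Mem}
    (h0 : s.reg 0 = n) (h1 : s.reg 1 = m) (h2 : s.reg 2 = 1) (h6 : s.reg 6 = K)
    (h7 : s.reg 7 = S) (h17 : s.reg 17 = 0) (hD : s.arr 6 = 0)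
    (hd : ∀ p < m, ∀ i < n, s.arr 5 (p * n + i) = d p i)
    (hr : ∀ p < m, ∀ i < n, s.arr 1 (p * n + i) = r p i) :
    fillLayers.WP s (m * (S * (n * 17 + 12) + 9) + 6) fun s' => s'.reg 18 = m * n ∧
      s'.reg 20 = m * S ∧ (∀ y < S, s'.arr 6 (m * S + y) = layer n d r K m y) ∧
      ∀ k < m, ∀ y < S, s'.arr 7 (k * S + y) = choice n d r K k y := by
  refine WP.mono (WP.step (T := 3) (WP.forLoop (T := S * (n * 17 + 12) + 6) (L := m)
    (fun k s' => s'.reg 18 = k * n ∧ s'.reg 20 = k * S ∧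
      (∀ y < S, s'.arr 6 (k * S + y) = layer n d r K k y) ∧
      ∀ k' < k, ∀ y < S, s'.arr 7 (k' * S + y) = choice n d r K k' y) ?_ ?_ ?_ ?_))
    (by ring_nf; omega) fun _ _ h => h
  · simp [eval, h2]
  · simp [eval, h1]
  · simp [eval, h17, h6, hD, layer]
  · rintro k hk s₁ hf hx ⟨hI18, hI20, hI6, hI7⟩
    have e0 : s₁.reg 0 = n := by rw [hf.reg 0 rfl]; simp [eval, h0]
    have e2 : s₁.reg 2 = 1 := by rw [hf.reg 2 rfl]; simp [eval, h2]
    have e7 : s₁.reg 7 = S := by rw [hf.reg 7 rfl]; simp [eval, h7]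
    have e17 : s₁.reg 17 = 0 := by rw [hf.reg 17 rfl]; simp [eval, h17]
    have e5 : ∀ i < n, s₁.arr 5 (k * n + i) = d k i := by
      rw [hf.arr 5 rfl]; simpa [eval] using hd k hk
    have e1 : ∀ i < n, s₁.arr 1 (k * n + i) = r k i := by
      rw [hf.arr 1 rfl]; simpa [eval] using hr k hk
    have hsucc : (k + 1) * S = k * S + S := Nat.succ_mul k S
    refine WP.mono (WP.step (T := 1) (WP.seq (Q' := fun s' =>
        (∀ y < S, s'.arr 6 ((k + 1) * S + y) = layer n d r K (k + 1) y) ∧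
        ∀ k' < k + 1, ∀ y < S, s'.arr 7 (k' * S + y) = choice n d r K k' y)
      (T₁ := S * (n * 17 + 9 + 3) + 3) ?_ fun s₂ hf₂ hs₂ =>
        WP.of_eval (T := 2) ?_)) (by ring_nf; omega) fun _ _ h => h
    · refine WP.mono (WP.forLoop (L := S) (T := n * 17 + 9) (fun y s' =>
        (∀ y' < S, s'.arr 6 (k * S + y') = layer n d r K k y') ∧
        (∀ y' < y, s'.arr 6 ((k + 1) * S + y') = layer n d r K (k + 1) y') ∧
        (∀ k' < k, ∀ y' < S, s'.arr 7 (k' * S + y') = choice n d r K k' y') ∧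
        ∀ y' < y, s'.arr 7 (k * S + y') = choice n d r K k y') ?_ ?_ ?_ ?_) le_rfl ?_
      · simp [eval, e2]
      · simp [eval, e7]
      · simpa [eval] using ⟨hI6, hI7⟩
      · rintro y hy s₂ hf₂ hx₂ ⟨hJ6, hJ6', hJ7, hJ7'⟩
        have e0' : s₂.reg 0 = n := by rw [hf₂.reg 0 rfl]; simp [eval, e0]
        have e2' : s₂.reg 2 = 1 := by rw [hf₂.reg 2 rfl]; simp [eval, e2]
        have e17' : s₂.reg 17 = 0 := by rw [hf₂.reg 17 rfl]; simp [eval, e17]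
        have e18' : s₂.reg 18 = k * n := by rw [hf₂.reg 18 rfl]; simp [eval, hI18]
        have e20' : s₂.reg 20 = k * S := by rw [hf₂.reg 20 rfl]; simp [eval, hI20]
        have e21' : s₂.reg 21 = (k + 1) * S := by
          rw [hf₂.reg 21 rfl]; simp [eval, hI20, e7, hsucc]
        have e5' : ∀ i < n, s₂.arr 5 (k * n + i) = d k i := by
          rw [hf₂.arr 5 rfl]; simpa [eval] using e5
        have e1' : ∀ i < n, s₂.arr 1 (k * n + i) = r k i := by
          rw [hf₂.arr 1 rfl]; simpa [eval] using e1
        refine WP.mono (WP.step (T := 2) (WP.seq (WP.forLoop (L := n) (T := 14)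
          (fun i s' => (s'.reg 22, s'.reg 23) = scan (fun i => if d k i ≤ y then
            layer n d r K k (y - d k i) - r k i else 0) i) ?_ ?_ ?_ ?_)
          fun s₃ hf₃ hs₃ => WP.of_eval (T := 4) ?_)) (by omega) fun _ _ h => h
        · simp [eval, e2']
        · simp [eval, e0']
        · simp [eval, scan]
        · intro i hi s₃ hf₃ hx₃ hL
          have a2 : s₃.reg 2 = 1 := by rw [hf₃.reg 2 rfl]; simp [eval, e2']
          have a15 : s₃.reg 15 = y := by rw [hf₃.reg 15 rfl]; simp [eval, hx₂]
          have a17 : s₃.reg 17 = 0 := by rw [hf₃.reg 17 rfl]; simp [eval, e17']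
          have a18 : s₃.reg 18 = k * n := by rw [hf₃.reg 18 rfl]; simp [eval, e18']
          have a20 : s₃.reg 20 = k * S := by rw [hf₃.reg 20 rfl]; simp [eval, e20']
          have a5 : s₃.arr 5 (k * n + i) = d k i := by
            rw [hf₃.arr 5 rfl]; simpa [eval] using e5' i hi
          have a1 : s₃.arr 1 (k * n + i) = r k i := by
            rw [hf₃.arr 1 rfl]; simpa [eval] using e1' i hi
          have a6 : ∀ y' < S, s₃.arr 6 (k * S + y') = layer n d r K k y' := by
            rw [hf₃.arr 6 rfl]; simpa [eval] using hJ6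
          refine WP.of_eval ?_
          rw [scan, ← hL]
          -- The machine tests `d k i ≤ y` as `y + 1 - d k i ≠ 0`.
          by_cases hdy : d k i ≤ y
          · have hdy' : ¬ (y + 1 - d k i = 0) := by omega
            have a6' := a6 (y - d k i) (by omega)
            rw [add_comm] at a6'
            by_cases hlt : s₃.reg 22 < layer n d r K k (y - d k i) - r k i
            · have hlt' : ¬ (layer n d r K k (y - d k i) - r k i - s₃.reg 22 = 0) := by omega
              simp [eval, hx₃, a2, a15, a17, a18, a20, a5, a1, hdy', hdy, a6', hlt', hlt]
            · have hlt' : layer n d r K k (y - d k i) - r k i - s₃.reg 22 = 0 := by omega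
              simp [eval, hx₃, a2, a15, a18, a20, a5, a1, hdy', hdy, a6', hlt', hlt]
          · have hdy' : y + 1 - d k i = 0 := by omega
            simp [eval, hx₃, a2, a15, a18, a5, hdy', hdy]
        · have b20 : s₃.reg 20 = k * S := by rw [hf₃.reg 20 rfl]; simp [eval, e20']
          have b21 : s₃.reg 21 = (k + 1) * S := by rw [hf₃.reg 21 rfl]; simp [eval, e21']
          have b15 : s₃.reg 15 = y := by rw [hf₃.reg 15 rfl]; simp [eval, hx₂]
          have b6 : s₃.arr 6 = s₂.arr 6 := by rw [hf₃.arr 6 rfl]; simp [eval]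
          have b7 : s₃.arr 7 = s₂.arr 7 := by rw [hf₃.arr 7 rfl]; simp [eval]
          have c6 : s₃.reg 22 = layer n d r K (k + 1) y := congrArg Prod.fst hs₃
          have c7 : s₃.reg 23 = choice n d r K k y := congrArg Prod.snd hs₃
          refine ⟨fun y' hy' => ?_, fun y' hy' => ?_, fun k' hk' y' hy' => ?_, fun y' hy' => ?_⟩
          -- Layer `k` ends before cell `(k + 1) * S`, so writing layer `k + 1` does not disturb it.
          · have hne : k * S + y' ≠ (k + 1) * S + y := by omega
            simp [eval, b20, b21, b15, b6, hJ6 y' hy', hne]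
          · rcases Nat.lt_succ_iff_lt_or_eq.1 hy' with h | rfl
            · simp [eval, b20, b21, b15, b6, hJ6' y' h, h.ne]
            · simp [eval, b20, b21, b15, c6]
          · have hle : (k' + 1) * S ≤ k * S := Nat.mul_le_mul_right _ hk'
            rw [Nat.succ_mul] at hle
            have hne : k' * S + y' ≠ k * S + y := by omega
            simp [eval, b20, b21, b15, b7, hJ7 k' hk' y' hy', hne]
          · rcases Nat.lt_succ_iff_lt_or_eq.1 hy' with h | rfl
            · simp [eval, b20, b21, b15, b7, hJ7' y' h, h.ne]
            · simp [eval, b20, b21, b15, c7]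
      · rintro s' _ ⟨_, hs6, hs7, hs7'⟩
        refine ⟨hs6, fun k' hk' => ?_⟩
        rcases Nat.lt_succ_iff_lt_or_eq.1 hk' with h | rfl
        · exact hs7 k' h
        · exact hs7'
    · have b0 : s₂.reg 0 = n := by rw [hf₂.reg 0 rfl]; simp [eval, e0]
      have b17 : s₂.reg 17 = 0 := by rw [hf₂.reg 17 rfl]; simp [eval, e17]
      have b18 : s₂.reg 18 = k * n := by rw [hf₂.reg 18 rfl]; simp [eval, hI18]
      have b21 : s₂.reg 21 = (k + 1) * S := by
        rw [hf₂.reg 21 rfl]; simp [eval, hI20, e7, hsucc]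
      simpa [eval, b0, b17, b18, b21, Nat.succ_mul] using hs₂

/-- Find the best index and put it into register `27`. -/
def findBest : Program :=
  forLoop 15 7
    (.add 12 20 15 ;; .load 12 6 12 ;;
      .cond 12
        (.load 13 4 15 ;; .add 12 13 12 ;; .sub 13 12 26 ;;
          .cond 13 (.add 26 12 17 ;; .add 27 15 17) (.const 13 0))
        (.const 12 0))

theorem wp_findBest {S a : ℕ} {P D : ℕ → ℕ} {s : Mem} (h2 : s.reg 2 = 1) (h7 : s.reg 7 = S)
    (h17 : s.reg 17 = 0) (h20 : s.reg 20 = a) (h26 : s.reg 26 = 0) (h27 : s.reg 27 = 0)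
    (hP : ∀ y < S, s.arr 4 y = P y) (hD : ∀ y < S, s.arr 6 (a + y) = D y) :
    findBest.WP s (S * 12 + 3) fun s' =>
      s'.reg 27 = (scan (fun y => if D y = 0 then 0 else P y + D y) S).2 := by
  refine WP.mono (WP.forLoop (T := 9) (L := S) (fun y s' => (s'.reg 26, s'.reg 27) =
    scan (fun y => if D y = 0 then 0 else P y + D y) y) h2 h7 ?_ ?_) le_rfl
    fun _ _ h => congrArg Prod.snd h
  · simp [h26, h27, scan]
  · intro y hy s₁ hf hx hI
    have e4 : s₁.arr 4 y = P y := by rw [hf.arr 4 rfl, hP y hy]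
    have e6 : s₁.arr 6 (a + y) = D y := by rw [hf.arr 6 rfl, hD y hy]
    have e17 : s₁.reg 17 = 0 := by rw [hf.reg 17 rfl, h17]
    have e20 : s₁.reg 20 = a := by rw [hf.reg 20 rfl, h20]
    refine WP.of_eval ?_
    rw [scan, ← hI]
    by_cases h0 : D y = 0
    · simp [eval, hx, e20, e6, h0]
    · by_cases hlt : s₁.reg 26 < P y + D y
      · have hlt' : ¬ (P y + D y - s₁.reg 26 = 0) := by omega
        simp [eval, hx, e20, e6, e4, e17, h0, hlt, hlt']
      · have hlt' : P y + D y - s₁.reg 26 = 0 := by omega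
        simp [eval, hx, e20, e6, e4, h0, hlt, hlt']

/-- Find the assignment for the best index. -/
def backtrack : Program :=
  forLoop 14 1
    (.sub 20 20 7 ;; .add 12 20 27 ;; .load 12 7 12 ;; .sub 28 1 14 ;; .sub 28 28 2 ;;
      .store 2 28 12 ;; .sub 18 18 0 ;; .add 13 18 12 ;; .load 13 5 13 ;; .sub 27 27 13)

theorem wp_backtrack {n m S K x : ℕ} {d r : ℕ → ℕ → ℕ} {s : Mem} (hn : 0 < n) (hx : x < S)
    (h0 : s.reg 0 = n) (h1 : s.reg 1 = m) (h2 : s.reg 2 = 1) (h7 : s.reg 7 = S)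
    (h18 : s.reg 18 = m * n) (h20 : s.reg 20 = m * S) (h27 : s.reg 27 = x)
    (hd : ∀ p < m, ∀ i < n, s.arr 5 (p * n + i) = d p i)
    (hc : ∀ k < m, ∀ y < S, s.arr 7 (k * S + y) = choice n d r K k y) :
    backtrack.WP s (m * 13 + 3) fun s' => ∀ p < m, s'.arr 2 p = assign n d r K m x p := by
  -- Register 27 holds the index left for the first `m - j` players. It must stay below `S` for the
  -- lookup of `choice` to be valid.
  refine WP.mono (WP.forLoop (T := 10) (L := m) (fun j s' => s'.reg 18 = (m - j) * n ∧
    s'.reg 20 = (m - j) * S ∧ s'.reg 27 < S ∧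
    (∀ p < m - j, assign n d r K m x p = assign n d r K (m - j) (s'.reg 27) p) ∧
    ∀ p < m, m - j ≤ p → s'.arr 2 p = assign n d r K m x p) h2 h1 ?_ ?_) le_rfl ?_
  · refine ⟨by simp [h18], by simp [h20], by simpa [h27] using hx, by simp [h27], ?_⟩
    intro p hp hp'
    omega
  · rintro j hj s₁ hf hxj ⟨hI18, hI20, hI27, hIa, hI2⟩
    -- Players are treated from last to first: round `j` settles player `k = m - j - 1`.
    obtain ⟨k, hk⟩ : ∃ k, m - j = k + 1 := ⟨m - j - 1, by omega⟩
    have hk' : m - (j + 1) = k := by omega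
    rw [hk] at hI18 hI20 hIa hI2
    have hkm : k < m := by omega
    have e0 : s₁.reg 0 = n := by rw [hf.reg 0 rfl, h0]
    have e1 : s₁.reg 1 = m := by rw [hf.reg 1 rfl, h1]
    have e2 : s₁.reg 2 = 1 := by rw [hf.reg 2 rfl, h2]
    have e7 : s₁.reg 7 = S := by rw [hf.reg 7 rfl, h7]
    have ec : s₁.arr 7 (k * S + s₁.reg 27) = choice n d r K k (s₁.reg 27) := by
      rw [hf.arr 7 rfl, hc k hkm _ hI27]
    have ed : s₁.arr 5 (k * n + choice n d r K k (s₁.reg 27)) =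
        d k (choice n d r K k (s₁.reg 27)) := by
      rw [hf.arr 5 rfl, hd k hkm _ (choice_lt hn _ _)]
    have esub : m - j - 1 = k := by omega
    have eS : (k + 1) * S - S = k * S := by rw [Nat.succ_mul, Nat.add_sub_cancel]
    have eN : (k + 1) * n - n = k * n := by rw [Nat.succ_mul, Nat.add_sub_cancel]
    refine WP.of_eval ?_
    rw [hk']
    simp only [eval, Mem.reg_setReg, Mem.arr_setReg, Mem.reg_setArr, Mem.arr_setArr_self]
    norm_num
    simp only [hxj, e0, e1, e2, e7, hI18, hI20, eS, eN, ec, ed, esub, true_and]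
    refine ⟨lt_of_le_of_lt (Nat.sub_le _ _) hI27, fun p hp => ?_, fun p hp hp' => ?_⟩
    · rw [hIa p (by omega), assign, if_neg hp.ne]
    · split_ifs with h
      · rw [hIa p (by omega), assign, if_pos h]
      · exact hI2 p hp (by omega)
  · rintro s' _ ⟨_, _, _, _, h⟩ p hp
    exact h p hp (by omega)

end Program

/-! ### Size of the base, assembly of the program and its running time. -/

theorem Market.base_pos {n m : ℕ} (I : Market n m) : 0 < I.base := by
  unfold Market.base
  omega

theorem Market.valueArr_le_vmax {n m : ℕ} (I : Market n m) (a : ℕ) : I.valueArr a ≤ I.vmax := by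
  unfold Market.valueArr tableArr
  split_ifs with h
  · exact Finset.le_sup (f := fun x : Fin n × Fin m => I.v x.1 x.2)
      (Finset.mem_univ (Fin.modNat ⟨a, h⟩, Fin.divNat ⟨a, h⟩))
  · exact Nat.zero_le _

theorem Market.valueArr_le_base {n m : ℕ} (I : Market n m) (a : ℕ) : I.valueArr a ≤ I.base := by
  by_cases h : a < m * n
  · have := Finset.single_le_sum (f := I.valueArr) (fun _ _ => Nat.zero_le _)
      (Finset.mem_range.2 h)
    unfold Market.base
    omega
  · simp [Market.valueArr, tableArr, h]

theorem Market.base_le {n m : ℕ} (I : Market n m) : I.base ≤ 1 + m * n * I.vmax := by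
  unfold Market.base
  have := Finset.sum_le_sum fun a (_ : a ∈ Finset.range (m * n)) => I.valueArr_le_vmax a
  simpa using this

namespace Program

/-- The algorithm. -/
def optimize : Program :=
  prepare ;; fillTables ;; fillWeights ;; fillLayers ;; findBest ;; backtrack

/-- A bound on the number of steps of `optimize`. -/
def runTime (n m B : ℕ) : ℕ :=
  (4 * m + 5 * (m * n) + 9) + ((n * (B * (9 * B ^ n + 6) + 9) + 6) +
    ((m * (n * (4 * B + 11) + 6) + 3) + ((m * (B ^ n * (n * 17 + 12) + 9) + 6) +
      ((B ^ n * 12 + 3) + (m * 13 + 3)))))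

theorem wp_optimize {n m : ℕ} (hn : 0 < n) (I : Market n m) :
    optimize.WP I.input (runTime n m I.base) fun s' => ∀ p < m, s'.arr 2 p = I.bestAssign p := by
  have i0 : I.input.reg 0 = n := rfl
  have i1 : I.input.reg 1 = m := rfl
  have iV : I.input.arr 0 = I.valueArr := rfl
  have iR : I.input.arr 1 = I.rankArr := rfl
  refine WP.seq (wp_prepare i0 i1 rfl rfl iV) fun s₁ f₁ ⟨h₁2, h₁4, h₁6⟩ => ?_
  have h₁0 : s₁.reg 0 = n := by rw [f₁.reg 0 rfl, i0]
  have h₁17 : s₁.reg 17 = 0 := f₁.reg 17 rfl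
  refine WP.seq (wp_fillTables I.base_pos h₁0 h₁2 h₁4 h₁6 h₁17) fun s₂ f₂ ⟨h₂7, h₂3, h₂4⟩ => ?_
  have h₂0 : s₂.reg 0 = n := by rw [f₂.reg 0 rfl, h₁0]
  have h₂1 : s₂.reg 1 = m := by rw [f₂.reg 1 rfl, f₁.reg 1 rfl, i1]
  have h₂2 : s₂.reg 2 = 1 := by rw [f₂.reg 2 rfl, h₁2]
  have h₂18 : s₂.reg 18 = 0 := by rw [f₂.reg 18 rfl, f₁.reg 18 rfl]; rfl
  have h₂V : s₂.arr 0 = I.valueArr := by rw [f₂.arr 0 rfl, f₁.arr 0 rfl, iV]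
  refine WP.seq (wp_fillWeights I.valueArr_le_base h₂0 h₂1 h₂2 h₂18 h₂V h₂3)
    fun s₃ f₃ ⟨_, h₃5⟩ => ?_
  have h₃0 : s₃.reg 0 = n := by rw [f₃.reg 0 rfl, h₂0]
  have h₃1 : s₃.reg 1 = m := by rw [f₃.reg 1 rfl, h₂1]
  have h₃2 : s₃.reg 2 = 1 := by rw [f₃.reg 2 rfl, h₂2]
  have h₃6 : s₃.reg 6 = I.bigNumber := by rw [f₃.reg 6 rfl, f₂.reg 6 rfl, h₁6]; rfl
  have h₃7 : s₃.reg 7 = I.base ^ n := by rw [f₃.reg 7 rfl, h₂7]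
  have h₃17 : s₃.reg 17 = 0 := by rw [f₃.reg 17 rfl, f₂.reg 17 rfl, h₁17]
  have h₃D : s₃.arr 6 = 0 := by rw [f₃.arr 6 rfl, f₂.arr 6 rfl, f₁.arr 6 rfl]; rfl
  have h₃R : s₃.arr 1 = I.rankArr := by rw [f₃.arr 1 rfl, f₂.arr 1 rfl, f₁.arr 1 rfl, iR]
  have hd : ∀ p < m, ∀ i < n, s₃.arr 5 (p * n + i) = I.weight p i := by
    intro p hp i hi
    have hle : (p + 1) * n ≤ m * n := Nat.mul_le_mul_right _ hp
    rw [Nat.succ_mul] at hle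
    rw [h₃5 _ (by omega), Nat.mul_add_mod_self_right, Nat.mod_eq_of_lt hi, Market.weight]
  refine WP.seq (wp_fillLayers (r := fun p i => I.rankArr (p * n + i)) h₃0 h₃1 h₃2 h₃6 h₃7 h₃17
    h₃D hd fun p _ i _ => by rw [h₃R]) fun s₄ f₄ ⟨h₄18, h₄20, h₄6, h₄7⟩ => ?_
  have h₄2 : s₄.reg 2 = 1 := by rw [f₄.reg 2 rfl, h₃2]
  have h₄S : s₄.reg 7 = I.base ^ n := by rw [f₄.reg 7 rfl, h₃7]
  have h₄17 : s₄.reg 17 = 0 := by rw [f₄.reg 17 rfl, h₃17]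
  have h₄26 : s₄.reg 26 = 0 := by
    rw [f₄.reg 26 rfl, f₃.reg 26 rfl, f₂.reg 26 rfl, f₁.reg 26 rfl]; rfl
  have h₄27 : s₄.reg 27 = 0 := by
    rw [f₄.reg 27 rfl, f₃.reg 27 rfl, f₂.reg 27 rfl, f₁.reg 27 rfl]; rfl
  have h₄P : ∀ y < I.base ^ n, s₄.arr 4 y = prodTable I.base I.bigNumber n y := by
    intro y hy
    rw [f₄.arr 4 rfl, f₃.arr 4 rfl, h₂4 y hy]
    rfl
  refine WP.seq (wp_findBest h₄2 h₄S h₄17 h₄20 h₄26 h₄27 h₄P h₄6) fun s₅ f₅ h₅27 => ?_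
  exact wp_backtrack (K := I.bigNumber) (d := I.weight)
    (r := fun p i => I.rankArr (p * n + i)) (x := I.bestIndex) hn
    (scan_snd_lt _ (Nat.pow_pos I.base_pos))
    (by rw [f₅.reg 0 rfl, f₄.reg 0 rfl, h₃0]) (by rw [f₅.reg 1 rfl, f₄.reg 1 rfl, h₃1])
    (by rw [f₅.reg 2 rfl, h₄2]) (by rw [f₅.reg 7 rfl, h₄S]) (by rw [f₅.reg 18 rfl, h₄18])
    (by rw [f₅.reg 20 rfl, h₄20]) h₅27 (by rw [f₅.arr 5 rfl, f₄.arr 5 rfl]; exact hd)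
    (by rw [f₅.arr 7 rfl]; exact h₄7)

theorem runTime_mono {n m m' B B' : ℕ} (hm : m ≤ m') (hB : B ≤ B') :
    runTime n m B ≤ runTime n m' B' := by
  unfold runTime
  gcongr

open Polynomial in
/-- For a fixed number of teams, the running time is bounded by a polynomial. -/
theorem exists_polynomial_runTime (n : ℕ) :
    ∃ q : ℕ[X], ∀ x, q.eval x = runTime n x (1 + x * n * x) := by
  set B : ℕ[X] := 1 + X * C n * X with hB
  refine ⟨(4 * X + 5 * (X * C n) + 9) + ((C n * (B * (9 * B ^ n + 6) + 9) + 6) +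
    ((X * (C n * (4 * B + 11) + 6) + 3) + ((X * (B ^ n * (C n * 17 + 12) + 9) + 6) +
      ((B ^ n * 12 + 3) + (X * 13 + 3))))), fun x => ?_⟩
  simp [hB, runTime]

end Program

end TeamAlloc
/-- There is one algorithm, taking the instance (with its number of teams) as input, that always
computes an EF1 and PO allocation and, for each fixed number `n ≥ 1` of teams, runs in time
polynomial in the number `m` of players and the largest value. -/
theorem theorem8 :
    ∃ c : TeamAlloc.Program, ∀ n : ℕ, 0 < n → ∃ q : Polynomial ℕ,
      ∀ (m : ℕ) (I : TeamAlloc.Market n m), ∃ A : TeamAlloc.Allocation n m,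
        I.EF1 A ∧ I.PO A ∧ c.OutputsWithin I A (q.eval (m + I.vmax)) := by
  refine ⟨TeamAlloc.Program.optimize, fun n hn => ?_⟩
  obtain ⟨q, hq⟩ := TeamAlloc.Program.exists_polynomial_runTime n
  refine ⟨q, fun m I => ?_⟩
  have hopt := TeamAlloc.Market.optimal_bestAllocation (I := I) hn
  refine ⟨I.bestAllocation hn, hopt.ef1, hopt.po, ?_⟩
  obtain ⟨t, ht, s, he, hs⟩ := TeamAlloc.Program.wp_optimize hn I
  refine ⟨t, ht.trans ?_, s, he, fun p => hs p p.2⟩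
  rw [hq]
  -- With `x = m + vmax`, both `m` and `vmax` are at most `x`, so the base is at most `1 + x * n *
  -- x`, the form used for the polynomial.
  refine TeamAlloc.Program.runTime_mono (Nat.le_add_right _ _) (I.base_le.trans ?_)
  gcongr <;> omega
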